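/- Let $\mathcal H_2$ be the set of formulas built from propositional variables $p_1,p_2,\dots$ and nominals $n_1,n_2,\dots$ by the Boolean connectives and two modal operators $\Box$ and $\Box_h$. Formulas are interpreted in frames $(W,R,S)$ with $R,S\subseteq W\times W$: a valuation assigns to each $p_i$ a subset of $W$ and to each nominal $n_i$ a singleton subset of $W$; $p_i$ and $n_i$ are true at the points of the sets assigned to them; the Boolean connectives have their usual meaning at each point; $\Box\varphi$ is true at $x$ iff $\varphi$ is true at all $y$ with $xRy$, and $\Box_h\varphi$ is true at $x$ iff $\varphi$ is true at all $y$ with $xSy$. A formula is valid in a frame if it is true at every point under every valuation. Let $\mathsf K_{\mathcal H_2}$ be the set of formulas valid in all frames, and let $\mathsf K_{\mathcal H_2}\oplus 45$ be the set of formulas valid in all frames $(W,R,S)$ with $R$ transitive and $S=W\times W$. A substitution $\sigma$ maps every propositional variable to a formula, and is extended to all formulas by leaving nominals intact and commuting with all connectives and modal operators. Let $L$ be any set of formulas (in particular, any logic) with $\mathsf K_{\mathcal H_2}\subseteq L\subseteq \mathsf K_{\mathcal H_2}\oplus 45$. Then both of the following problems are (algorithmically) undecidable: 1. the unification problem for $L$: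 given a formula $\varphi$, decide whether there is a substitution $\sigma$ with $\sigma(\varphi)\in L$; 2. the admissibility problem for $L$: given an inference rule $\varphi_1,\dots,\varphi_m/\varphi$, decide whether, for every substitution $\sigma$, $\sigma(\varphi_1)\in L,\dots,\sigma(\varphi_m)\in L$ imply $\sigma(\varphi)\in L$. -/

import Mathlib

universe u

namespace HybridLogic

/-- Formulas of the bimodal language with nominals: propositional variables `var i`, nominals
`nom i` (`i = 0, 1, 2, …`), Boolean connectives, and the two boxes `□` and `□ₕ`. -/
inductive Formula : Type
  | bot : Formula
  | var : ℕ → Formula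
  | nom : ℕ → Formula
  | neg : Formula → Formula
  | box : Formula → Formula
  | boxh : Formula → Formula
  | and : Formula → Formula → Formula

namespace Formula

/-- The Gödel numbering of formulas. -/
def code : Formula → ℕ
  | bot => 0
  | var i => 6 * i + 1
  | nom i => 6 * i + 2
  | neg φ => 6 * code φ + 3
  | box φ => 6 * code φ + 4
  | boxh φ => 6 * code φ + 5
  | and φ ψ => 6 * Nat.pair (code φ) (code ψ) + 6

/-- The inverse of the Gödel numbering. -/
def ofCode : ℕ → Formula
  | 0 => bot
  | n + 1 =>
    match n % 6 with
    | 0 => var (n / 6)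
    | 1 => nom (n / 6)
    | 2 => neg (ofCode (n / 6))
    | 3 => box (ofCode (n / 6))
    | 4 => boxh (ofCode (n / 6))
    | _ => and (ofCode (n / 6).unpair.1) (ofCode (n / 6).unpair.2)
  decreasing_by
    all_goals
      have h : n / 6 < n + 1 := Nat.lt_succ_of_le (Nat.div_le_self n 6)
      first
        | exact h
        | exact lt_of_le_of_lt (Nat.unpair_left_le _) h
        | exact lt_of_le_of_lt (Nat.unpair_right_le _) h

theorem ofCode_code (φ : Formula) : ofCode (code φ) = φ := by
  have hd : ∀ a r : ℕ, r < 6 → (6 * a + r) / 6 = a := by omega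
  have hm : ∀ a r : ℕ, r < 6 → (6 * a + r) % 6 = r := by omega
  induction φ with
  | bot => simp [code, ofCode]
  | var i =>
    rw [code, ofCode]
    simp
  | nom i =>
    rw [code, ofCode]
    simp [hd _ 1, hm _ 1]
  | neg φ ih =>
    rw [code, ofCode]
    simp [hd _ 2, hm _ 2, ih]
  | box φ ih =>
    rw [code, ofCode]
    simp [hd _ 3, hm _ 3, ih]
  | boxh φ ih =>
    rw [code, ofCode]
    simp [hd _ 4, hm _ 4, ih]
  | and φ ψ ih₁ ih₂ =>
    rw [code, ofCode]
    simp [hd _ 5, hm _ 5, ih₁, ih₂]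

theorem code_ofCode (n : ℕ) : code (ofCode n) = n := by
  induction n using Nat.strong_induction_on with
  | _ n ih =>
    cases n with
    | zero => simp [code, ofCode]
    | succ n =>
      have h : n / 6 < n + 1 := Nat.lt_succ_of_le (Nat.div_le_self n 6)
      have h₁ : (n / 6).unpair.1 < n + 1 := lt_of_le_of_lt (Nat.unpair_left_le _) h
      have h₂ : (n / 6).unpair.2 < n + 1 := lt_of_le_of_lt (Nat.unpair_right_le _) h
      rw [ofCode]
      split
      · rw [code]; omega
      · rw [code]; omega
      · rw [code, ih _ h]; omega
      · rw [code, ih _ h]; omega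
      · rw [code, ih _ h]; omega
      · rename_i h0 h1 h2 h3 h4
        have h5 : n % 6 = 5 := by
          have : n % 6 < 6 := Nat.mod_lt _ (by norm_num)
          interval_cases n % 6 <;> simp_all
        rw [code, ih _ h₁, ih _ h₂, Nat.pair_unpair]; omega

/-- Formulas are presented to algorithms by their Gödel numbers; through this instance Mathlib's
`ComputablePred` applies to sets of formulas and to sets of inference rules. -/
instance : Denumerable Formula :=
  Denumerable.mk' ⟨code, ofCode, ofCode_code, code_ofCode⟩

/-- The uniform substitution of `σ i` for the variable `var i`; nominals are left intact. -/
def subst (σ : ℕ → Formula) : Formula → Formula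
  | bot => bot
  | var i => σ i
  | nom i => nom i
  | neg φ => neg (subst σ φ)
  | box φ => box (subst σ φ)
  | boxh φ => boxh (subst σ φ)
  | and φ ψ => and (subst σ φ) (subst σ ψ)

end Formula

/-- A frame `(W, R, S)` with two binary relations. -/
structure Frame where
  W : Type u
  R : W → W → Prop
  S : W → W → Prop

/-- A valuation in a frame: variables denote sets of points; the nominal `nom i` denotes a
singleton, given by its only element `nom i`. -/
structure Valuation (F : Frame.{u}) where
  var : ℕ → Set F.W
  nom : ℕ → F.W

/-- Truth of a formula at a point of a model. -/
def Truth (F : Frame.{u}) (V : Valuation F) : F.W → Formula → Prop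
  | _, .bot => False
  | x, .var i => x ∈ V.var i
  | x, .nom i => x = V.nom i
  | x, .neg φ => ¬ Truth F V x φ
  | x, .box φ => ∀ y, F.R x y → Truth F V y φ
  | x, .boxh φ => ∀ y, F.S x y → Truth F V y φ
  | x, .and φ ψ => Truth F V x φ ∧ Truth F V x ψ

/-- Validity in a frame: truth at every point under every valuation. -/
def Frame.Valid (F : Frame.{u}) (φ : Formula) : Prop :=
  ∀ (V : Valuation F) (x : F.W), Truth F V x φ

/-- The logic `K_{H₂}`: the formulas valid in all frames. -/
def KH2 : Set Formula :=
  {φ | ∀ F : Frame.{u}, F.Valid φ}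

/-- The logic `K_{H₂} ⊕ 45`: the formulas valid in all frames `(W, R, S)` with `R` transitive and
`S = W × W`. -/
def KH2_45 : Set Formula :=
  {φ | ∀ F : Frame.{u}, (∀ x y z, F.R x y → F.R y z → F.R x z) → (∀ x y, F.S x y) → F.Valid φ}

/-- `φ` is unifiable in `L`: some substitution instance of `φ` belongs to `L`. -/
def Unifiable (L : Set Formula) (φ : Formula) : Prop :=
  ∃ σ : ℕ → Formula, φ.subst σ ∈ L

/-- An inference rule `φ₁, …, φₙ / φ`, given by its premises and its conclusion, is admissible in
`L`: every substitution that puts all the premises into `L` also puts the conclusion into `L`. -/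
def Admissible (L : Set Formula) (r : List Formula × Formula) : Prop :=
  ∀ σ : ℕ → Formula, (∀ φ ∈ r.1, φ.subst σ ∈ L) → r.2.subst σ ∈ L

end HybridLogic

/-! Derivability from Horn clauses over zero and successor is reduced to unifiability. Partial
recursive functions have graphs given by finite lists of such clauses, so some list `C` has an
undecidable derivability problem (`Horn.exists_undecidable`).

The formula `reduction C f` says, at the point named by nominal 0, that if all clauses of `C` hold
then so does `f`. Clause variables become propositional variables, and in the intended frame a
formula denotes the least number at which it is true; a substitution thus chooses one value for each
variable in each model.

If `f` is derivable, some derivation uses finitely many clause instances, and wherever `f` is false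
one of them fails. The unifier sends each variable to its numeral in the first failing instance, so
the clause itself fails, against the hypothesis. Nominal 0 lets distant points make the same choice,
and `linked` ensures that the relevant points see it. This works in all frames
(`exists_valid_subst`).

Conversely, a unifier is tested in one transitive frame with universal `S`, built from the derivable
facts. All clauses hold there under every valuation, so `f` is true, hence derivable
(`derives_of_valid_subst`). The two directions concern the smallest and the largest logic, so every
`L` in between is covered. Finally, the rule `φ / ⊥` is admissible iff `φ` is not unifiable. -/

namespace Horn

/-! ### Horn clauses and derivations -/

/-- Terms over zero and successor. -/
inductive Term : Type
  | zero : Term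
  | var : ℕ → Term
  | succ : Term → Term

namespace Term

def eval (ν : ℕ → ℕ) : Term → ℕ
  | zero => 0
  | var i => ν i
  | succ t => eval ν t + 1

def vars : Term → List ℕ
  | zero => []
  | var i => [i]
  | succ t => vars t

def ofNat : ℕ → Term
  | 0 => zero
  | n + 1 => succ (ofNat n)

theorem eval_ofNat (ν : ℕ → ℕ) (n : ℕ) : (ofNat n).eval ν = n := by
  induction n with
  | zero => rfl
  | succ n ih => simp [ofNat, eval, ih]

theorem vars_ofNat (n : ℕ) : (ofNat n).vars = [] := by
  induction n with
  | zero => rfl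
  | succ n ih => simpa [ofNat, vars] using ih

end Term

/-- An atom is a predicate symbol applied to a list of terms. -/
abbrev Atom (α : Type*) := α × List Term

/-- A ground atom. -/
abbrev Fact (α : Type*) := α × List ℕ

/-- A Horn clause: the list of its premises and its head. -/
abbrev Clause (α : Type*) := List (Atom α) × Atom α

variable {α : Type*}

def Atom.inst (ν : ℕ → ℕ) (a : Atom α) : Fact α := (a.1, a.2.map (Term.eval ν))

def Atom.vars (a : Atom α) : List ℕ := a.2.flatMap Term.vars

/-- The facts derivable from a list of Horn clauses. -/
inductive Derives (C : List (Clause α)) : Fact α → Prop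
  | step (c : Clause α) (hc : c ∈ C) (ν : ℕ → ℕ)
      (h : ∀ a ∈ c.1, Derives C (Atom.inst ν a)) : Derives C (Atom.inst ν c.2)

/-- The clauses of `C` hold in the interpretation `I`. -/
def Holds (I : Fact α → Prop) (C : List (Clause α)) : Prop :=
  ∀ c ∈ C, ∀ ν, (∀ a ∈ c.1, I (Atom.inst ν a)) → I (Atom.inst ν c.2)

theorem Derives.sound {C : List (Clause α)} {I : Fact α → Prop} (hI : Holds I C) {f : Fact α}
    (h : Derives C f) : I f := by
  induction h with
  | step c hc ν _ ih => exact hI c hc ν ih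

theorem Derives.mono {C D : List (Clause α)} (hCD : ∀ c ∈ C, c ∈ D) {f : Fact α}
    (h : Derives C f) : Derives D f := by
  induction h with
  | step c hc ν _ ih => exact .step c (hCD c hc) ν ih

theorem Derives.of_clause {C : List (Clause α)} {p : List (Atom α)} {a : Atom α}
    (hc : (p, a) ∈ C) (ν : ℕ → ℕ) {f : Fact α} (hf : Atom.inst ν a = f)
    (h : ∀ b ∈ p, Derives C (Atom.inst ν b)) : Derives C f :=
  hf ▸ Derives.step (p, a) hc ν h

/-- A derivation uses finitely many clause instances. -/
theorem Derives.exists_instances {C : List (Clause α)} {f : Fact α} (h : Derives C f) :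
    ∃ D : List (Clause α × (ℕ → ℕ)), (∀ d ∈ D, d.1 ∈ C) ∧
      ∀ T : Fact α → Prop, (∀ d ∈ D, (∀ a ∈ d.1.1, T (Atom.inst d.2 a)) →
        T (Atom.inst d.2 d.1.2)) → T f := by
  induction h with
  | step c hc ν _ ih =>
    choose! D hD hT using ih
    refine ⟨(c, ν) :: c.1.flatMap D, ?_, ?_⟩
    · intro d hd
      rcases List.mem_cons.1 hd with rfl | hd
      · exact hc
      · obtain ⟨a, ha, hd⟩ := List.mem_flatMap.1 hd
        exact hD a ha d hd
    · intro T h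
      refine h (c, ν) (by simp) fun a ha => hT a ha T fun d hd => h d ?_
      exact List.mem_cons_of_mem _ (List.mem_flatMap.2 ⟨a, ha, hd⟩)

/-! ### Graphs of partial recursive functions -/

/-- Predicates on lists of numbers, serving as their own symbols. -/
abbrev Pred := List ℕ → Prop

/-- The interpretation in which every symbol denotes itself. -/
def selfTrue (f : Fact Pred) : Prop := f.1 f.2

/-- `P` is derivable from finitely many true Horn clauses. -/
def Definable (P : Pred) : Prop :=
  ∃ C : List (Clause Pred), Holds selfTrue C ∧ ∀ l, P l → Derives C (P, l)

/-- As predicates are their own symbols and all clauses are true, lists of clauses can be united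
without renaming or loss of soundness. -/
theorem Definable.exists_common {n : ℕ} {P : Fin n → Pred} (h : ∀ i, Definable (P i)) :
    ∃ C : List (Clause Pred), Holds selfTrue C ∧ ∀ i l, P i l → Derives C (P i, l) := by
  choose C hC hD using h
  refine ⟨(List.finRange n).flatMap C, ?_, ?_⟩
  · intro c hc
    obtain ⟨i, -, hc⟩ := List.mem_flatMap.1 hc
    exact hC i c hc
  · intro i l hl
    exact (hD i l hl).mono fun c hc => List.mem_flatMap.2 ⟨i, List.mem_finRange i, hc⟩

theorem Holds.append {I : Fact α → Prop} {C D : List (Clause α)} (hC : Holds I C)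
    (hD : Holds I D) : Holds I (C ++ D) := by
  intro c hc
  rcases List.mem_append.1 hc with hc | hc
  · exact hC c hc
  · exact hD c hc

theorem Holds.cons {I : Fact α → Prop} {p : List (Atom α)} {a : Atom α} {C : List (Clause α)}
    (h : ∀ ν, (∀ b ∈ p, I (Atom.inst ν b)) → I (Atom.inst ν a)) (hC : Holds I C) :
    Holds I ((p, a) :: C) := by
  intro c hc
  rcases List.mem_cons.1 hc with rfl | hc
  · exact h
  · exact hC c hc

theorem Holds.nil {I : Fact α → Prop} : Holds I [] := by simp [Holds]

/-- The graph of a partial function, with the value listed first. -/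
def graph {n : ℕ} (f : List.Vector ℕ n → Part ℕ) : Pred :=
  fun l => ∃ v y, y ∈ f v ∧ l = y :: v.toList

theorem graph_cons {n : ℕ} (f : List.Vector ℕ n → Part ℕ) (v : List.Vector ℕ n) (y : ℕ) :
    graph f (y :: v.toList) ↔ y ∈ f v := by
  constructor
  · rintro ⟨w, z, hz, h⟩
    obtain ⟨rfl, hvw⟩ := List.cons.inj h
    rwa [List.Vector.eq _ _ hvw]
  · exact fun h => ⟨v, y, h, rfl⟩

/-- The variables `o + 2, …, o + n + 1`. -/
def vecTerms (o n : ℕ) : List Term := List.ofFn fun i : Fin n => Term.var (o + i + 2)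

def vecVal (ν : ℕ → ℕ) (o n : ℕ) : List.Vector ℕ n := List.Vector.ofFn fun i => ν (o + i + 2)

theorem map_vecTerms (ν : ℕ → ℕ) (o n : ℕ) :
    (vecTerms o n).map (Term.eval ν) = (vecVal ν o n).toList := by
  simp [vecTerms, vecVal, List.map_ofFn, Function.comp_def, Term.eval]

/-- Variables 0 and 1 are scratch values; the list starts at variable 2, matching the offset in
`vecTerms`. -/
def assign (a b : ℕ) (l : List ℕ) : ℕ → ℕ
  | 0 => a
  | 1 => b
  | i + 2 => l.getD i 0

theorem vecVal_assign (a b : ℕ) (l l' : List ℕ) {n : ℕ} (v : List.Vector ℕ n) :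
    vecVal (assign a b (l ++ (v.toList ++ l'))) l.length n = v := by
  apply List.Vector.ext
  intro i
  simp [vecVal, assign, List.Vector.get_eq_get_toList,
    List.getElem?_append]

theorem vecVal_assign_toList (a b : ℕ) {n : ℕ} (v : List.Vector ℕ n) :
    vecVal (assign a b v.toList) 0 n = v := by
  simpa using vecVal_assign a b [] [] v

theorem definable_zero : Definable (graph (n := 0) fun _ => Part.some 0) := by
  set P := graph (n := 0) fun _ => Part.some 0
  refine ⟨[([], (P, [Term.zero]))], .cons ?_ .nil, ?_⟩
  · intro ν _
    exact ⟨List.Vector.nil, 0, by simp, rfl⟩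
  · rintro _ ⟨v, y, hy, rfl⟩
    obtain rfl := Part.mem_some_iff.1 hy
    refine .of_clause (List.mem_singleton_self _) (fun _ => 0) ?_ (by simp)
    simp [Atom.inst, Term.eval, List.Vector.eq_nil v]

theorem definable_succ :
    Definable (graph (n := 1) fun v => Part.some (Nat.succ v.head)) := by
  set P := graph (n := 1) fun v => Part.some (Nat.succ v.head)
  refine ⟨[([], (P, [Term.succ (Term.var 0), Term.var 0]))], .cons ?_ .nil, ?_⟩
  · intro ν _
    exact ⟨ν 0 ::ᵥ List.Vector.nil, ν 0 + 1, by simp, rfl⟩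
  · rintro _ ⟨v, y, hy, rfl⟩
    obtain rfl := Part.mem_some_iff.1 hy
    refine .of_clause (List.mem_singleton_self _) (fun _ => v.head) ?_ (by simp)
    obtain ⟨a, w, rfl⟩ := v.exists_eq_cons
    simp [Atom.inst, Term.eval, List.Vector.eq_nil w]

theorem definable_get {n : ℕ} (i : Fin n) :
    Definable (graph fun v : List.Vector ℕ n => Part.some (v.get i)) := by
  set P := graph fun v : List.Vector ℕ n => Part.some (v.get i)
  refine ⟨[([], (P, Term.var (0 + i + 2) :: vecTerms 0 n))], .cons ?_ .nil, ?_⟩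
  · intro ν _
    refine ⟨vecVal ν 0 n, _, Part.mem_some _, ?_⟩
    rw [← map_vecTerms]
    simp [Atom.inst, Term.eval, vecVal]
  · rintro _ ⟨v, y, hy, rfl⟩
    obtain rfl := Part.mem_some_iff.1 hy
    refine .of_clause (List.mem_singleton_self _) (assign 0 0 v.toList) ?_ (by simp)
    simp only [Atom.inst, List.map_cons, map_vecTerms, vecVal_assign_toList]
    simp [Term.eval, assign, List.Vector.get_eq_get_toList]

theorem mem_mOfFn {n : ℕ} (f : Fin n → Part ℕ) (v : List.Vector ℕ n) :
    v ∈ List.Vector.mOfFn f ↔ ∀ i, v.get i ∈ f i := by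
  induction n with
  | zero => simp [List.Vector.mOfFn, List.Vector.eq_nil v]
  | succ n ih =>
    obtain ⟨a, w, rfl⟩ := v.exists_eq_cons
    simp only [List.Vector.mOfFn, Part.bind_eq_bind, Part.mem_bind_iff, ih, Fin.forall_fin_succ,
      List.Vector.get_zero, List.Vector.head_cons, List.Vector.get_cons_succ]
    constructor
    · rintro ⟨b, hb, u, hu, h⟩
      have hl := congrArg List.Vector.toList (Part.mem_some_iff.1 h)
      simp only [List.Vector.toList_cons, List.cons.injEq] at hl
      obtain ⟨rfl, hl⟩ := hl
      obtain rfl := List.Vector.eq _ _ hl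
      exact ⟨hb, hu⟩
    · rintro ⟨ha, hw⟩
      exact ⟨a, ha, w, hw, Part.mem_some _⟩

theorem definable_comp {m n : ℕ} {f : List.Vector ℕ n → Part ℕ}
    (g : Fin n → List.Vector ℕ m → Part ℕ)
    (hf : Definable (graph f)) (hg : ∀ i, Definable (graph (g i))) :
    Definable (graph fun v => (List.Vector.mOfFn fun i => g i v) >>= f) := by
  obtain ⟨C, hC, hCf⟩ := hf
  obtain ⟨D, hD, hDg⟩ := Definable.exists_common hg
  set P := graph fun v => (List.Vector.mOfFn fun i => g i v) >>= f with hP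
  have hmem (y : ℕ) (v : List.Vector ℕ m) :
      P (y :: v.toList) ↔ ∃ u, (∀ i, u.get i ∈ g i v) ∧ y ∈ f u := by
    rw [hP, graph_cons]
    simp [Part.bind_eq_bind, Part.mem_bind_iff, mem_mOfFn]
  refine ⟨((graph f, Term.var 0 :: vecTerms m n) ::
    List.ofFn (fun i : Fin n => (graph (g i), Term.var (m + i + 2) :: vecTerms 0 m)),
    (P, Term.var 0 :: vecTerms 0 m)) :: (C ++ D), .cons ?_ (hC.append hD), ?_⟩
  · intro ν h
    simp only [List.forall_mem_cons, List.forall_mem_ofFn_iff, Atom.inst, selfTrue,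
      List.map_cons, map_vecTerms, graph_cons, Term.eval, hmem] at h ⊢
    exact ⟨_, fun i => by simpa [vecVal] using h.2 i, h.1⟩
  · intro l hl
    obtain ⟨v, y, -, rfl⟩ := id hl
    obtain ⟨u, hu, hy⟩ := (hmem y v).1 hl
    have hv : vecVal (assign y 0 (v.toList ++ u.toList)) 0 m = v := by
      simpa using vecVal_assign y 0 [] u.toList v
    have hu' : vecVal (assign y 0 (v.toList ++ u.toList)) m n = u := by
      simpa using vecVal_assign y 0 v.toList [] u
    refine .of_clause (List.mem_cons_self) (assign y 0 (v.toList ++ u.toList)) ?_ ?_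
    · simp [Atom.inst, Term.eval, map_vecTerms, hv, assign]
    · simp only [List.forall_mem_cons, List.forall_mem_ofFn_iff, Atom.inst, List.map_cons,
        map_vecTerms, Term.eval, hv, hu']
      constructor
      · exact (hCf _ ((graph_cons f u y).2 hy)).mono (by simp +contextual)
      · intro i
        refine (hDg i _ ((graph_cons _ v _).2 ?_)).mono (by simp +contextual)
        convert hu i using 1
        conv_rhs => rw [← hu']
        simp [vecVal]

theorem definable_prec {n : ℕ} {f : List.Vector ℕ n → ℕ} {g : List.Vector ℕ (n + 2) → ℕ}
    (hf : Definable (graph fun v => Part.some (f v)))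
    (hg : Definable (graph fun v => Part.some (g v))) :
    Definable (graph fun v : List.Vector ℕ (n + 1) =>
      Part.some (v.head.rec (f v.tail) fun y IH => g (y ::ᵥ IH ::ᵥ v.tail))) := by
  obtain ⟨C, hC, hCf⟩ := hf
  obtain ⟨D, hD, hDg⟩ := hg
  set F : List.Vector ℕ (n + 1) → ℕ :=
    fun v => v.head.rec (f v.tail) fun y IH => g (y ::ᵥ IH ::ᵥ v.tail) with hF
  change Definable (graph fun v => Part.some (F v))
  have hP (y a : ℕ) (v : List.Vector ℕ n) :
      graph (fun v => Part.some (F v)) (y :: a :: v.toList) ↔ y = F (a ::ᵥ v) := by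
    rw [← List.Vector.toList_cons, graph_cons, Part.mem_some_iff]
  have hQ (y a b : ℕ) (v : List.Vector ℕ n) :
      graph (fun v => Part.some (g v)) (y :: a :: b :: v.toList) ↔ y = g (a ::ᵥ b ::ᵥ v) := by
    rw [← List.Vector.toList_cons, ← List.Vector.toList_cons, graph_cons, Part.mem_some_iff]
  set P := graph fun v => Part.some (F v)
  set E : List (Clause Pred) :=
    ([(graph fun v => Part.some (f v), Term.var 0 :: vecTerms 0 n)],
      (P, Term.var 0 :: Term.zero :: vecTerms 0 n)) ::
    -- Variable 0 is the previous value, 1 the counter and 2 the new value; hence the arguments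
    -- start at offset 1.
    ([(P, Term.var 0 :: Term.var 1 :: vecTerms 1 n),
      (graph fun v => Part.some (g v), Term.var 2 :: Term.var 1 :: Term.var 0 :: vecTerms 1 n)],
      (P, Term.var 2 :: Term.succ (Term.var 1) :: vecTerms 1 n)) :: (C ++ D)
  refine ⟨E, .cons ?_ (.cons ?_ (hC.append hD)), ?_⟩
  · intro ν h
    simp only [List.forall_mem_singleton, Atom.inst, selfTrue, List.map_cons, map_vecTerms,
      graph_cons, Term.eval, hP, Part.mem_some_iff] at h ⊢
    simpa [hF] using h
  · intro ν h
    simp only [List.forall_mem_cons, Atom.inst, selfTrue, List.map_cons, map_vecTerms,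
      Term.eval, hP, hQ] at h ⊢
    rw [h.2.1, h.1]
    simp [hF]
  · have key (a : ℕ) (v : List.Vector ℕ n) : Derives E (P, F (a ::ᵥ v) :: a :: v.toList) := by
      induction a with
      | zero =>
        refine .of_clause (List.mem_cons_self) (assign (f v) 0 v.toList) ?_ ?_
        · simp [Atom.inst, Term.eval, map_vecTerms, vecVal_assign_toList, assign, hF]
        · simp only [List.forall_mem_singleton, Atom.inst, List.map_cons, map_vecTerms,
            Term.eval, vecVal_assign_toList, assign]
          exact (hCf _ ((graph_cons _ v _).2 (Part.mem_some _))).mono (by simp +contextual)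
      | succ a ih =>
        have hv : vecVal (assign (F (a ::ᵥ v)) a (F ((a + 1) ::ᵥ v) :: v.toList)) 1 n = v := by
          simpa using vecVal_assign (F (a ::ᵥ v)) a [F ((a + 1) ::ᵥ v)] [] v
        refine .of_clause (List.mem_cons_of_mem _ List.mem_cons_self)
          (assign (F (a ::ᵥ v)) a (F ((a + 1) ::ᵥ v) :: v.toList)) ?_ ?_
        · simp [Atom.inst, Term.eval, map_vecTerms, hv, assign]
        · simp only [List.forall_mem_cons, Atom.inst, List.map_cons, map_vecTerms,
            Term.eval, hv, assign]
          refine ⟨ih, ?_, by simp⟩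
          exact (hDg _ ((hQ _ _ _ _).2 (by simp [hF]))).mono (by simp +contextual)
    rintro _ ⟨v, y, hy, rfl⟩
    obtain rfl := Part.mem_some_iff.1 hy
    obtain ⟨a, w, rfl⟩ := v.exists_eq_cons
    exact key a w

theorem definable_rfind {n : ℕ} {f : List.Vector ℕ (n + 1) → ℕ}
    (hf : Definable (graph fun v => Part.some (f v))) :
    Definable (graph fun v : List.Vector ℕ n =>
      Nat.rfind fun m => Part.some (decide (f (m ::ᵥ v) = 0))) := by
  obtain ⟨C, hC, hCf⟩ := hf
  set P := graph fun v : List.Vector ℕ n =>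
    Nat.rfind fun m => Part.some (decide (f (m ::ᵥ v) = 0)) with hP
  have hmem (y : ℕ) (v : List.Vector ℕ n) :
      P (y :: v.toList) ↔ f (y ::ᵥ v) = 0 ∧ ∀ k < y, f (k ::ᵥ v) ≠ 0 := by
    rw [hP, graph_cons]
    refine Nat.mem_rfind.trans ?_
    simp [eq_comm]
  have hf' (y a : ℕ) (v : List.Vector ℕ n) :
      graph (fun v => Part.some (f v)) (y :: a :: v.toList) ↔ y = f (a ::ᵥ v) := by
    rw [← List.Vector.toList_cons, graph_cons, Part.mem_some_iff]
  -- Horn clauses have no negation, so the failure of the search below `y` becomes an auxiliary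
  -- predicate, with "nonzero" expressed as "a successor".
  set Q : Pred := fun l => ∃ (y : ℕ) (v : List.Vector ℕ n),
    (∀ k < y, f (k ::ᵥ v) ≠ 0) ∧ l = y :: v.toList with hQ
  have hQmem (y : ℕ) (v : List.Vector ℕ n) :
      Q (y :: v.toList) ↔ ∀ k < y, f (k ::ᵥ v) ≠ 0 := by
    constructor
    · rintro ⟨z, w, hz, h⟩
      obtain ⟨rfl, hvw⟩ := List.cons.inj h
      rwa [List.Vector.eq _ _ hvw]
    · exact fun h => ⟨y, v, h, rfl⟩
  set E : List (Clause Pred) :=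
    ([], (Q, Term.zero :: vecTerms 0 n)) ::
    ([(Q, Term.var 0 :: vecTerms 0 n),
      (graph fun v => Part.some (f v),
        Term.succ (Term.var 1) :: Term.var 0 :: vecTerms 0 n)],
      (Q, Term.succ (Term.var 0) :: vecTerms 0 n)) ::
    ([(Q, Term.var 0 :: vecTerms 0 n),
      (graph fun v => Part.some (f v), Term.zero :: Term.var 0 :: vecTerms 0 n)],
      (P, Term.var 0 :: vecTerms 0 n)) :: C
  refine ⟨E, .cons ?_ (.cons ?_ (.cons ?_ hC)), ?_⟩
  · intro ν _
    simp only [Atom.inst, selfTrue, List.map_cons, map_vecTerms, Term.eval, hQmem]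
    simp
  · intro ν h
    simp only [List.forall_mem_cons, Atom.inst, selfTrue, List.map_cons, map_vecTerms,
      Term.eval, hQmem, hf'] at h ⊢
    intro k hk
    rcases Nat.lt_succ_iff_lt_or_eq.1 hk with hk | rfl
    · exact h.1 k hk
    · omega
  · intro ν h
    simp only [List.forall_mem_cons, Atom.inst, selfTrue, List.map_cons, map_vecTerms,
      Term.eval, hQmem, hf', hmem] at h ⊢
    exact ⟨h.2.1.symm, h.1⟩
  · have key (y : ℕ) (v : List.Vector ℕ n) (h : ∀ k < y, f (k ::ᵥ v) ≠ 0) :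
        Derives E (Q, y :: v.toList) := by
      induction y with
      | zero =>
        refine .of_clause (List.mem_cons_self) (assign 0 0 v.toList) ?_ (by simp)
        simp [Atom.inst, Term.eval, map_vecTerms, vecVal_assign_toList]
      | succ y ih =>
        refine .of_clause (List.mem_cons_of_mem _ List.mem_cons_self)
          (assign y (f (y ::ᵥ v) - 1) v.toList) ?_ ?_
        · simp [Atom.inst, Term.eval, map_vecTerms, vecVal_assign_toList, assign]
        · simp only [List.forall_mem_cons, Atom.inst, List.map_cons, map_vecTerms,
            Term.eval, vecVal_assign_toList, assign]
          refine ⟨ih fun k hk => h k (by omega), ?_, by simp⟩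
          have := h y (by omega)
          exact (hCf _ ((hf' _ _ _).2 (by omega))).mono (by simp +contextual)
    intro l hl
    obtain ⟨v, y, -, rfl⟩ := id hl
    obtain ⟨h0, hlt⟩ := (hmem y v).1 hl
    refine .of_clause (List.mem_cons_of_mem _ (List.mem_cons_of_mem _ List.mem_cons_self))
      (assign y 0 v.toList) ?_ ?_
    · simp [Atom.inst, Term.eval, map_vecTerms, vecVal_assign_toList, assign]
    · simp only [List.forall_mem_cons, Atom.inst, List.map_cons, map_vecTerms,
        Term.eval, vecVal_assign_toList, assign]
      exact ⟨key y v hlt, (hCf _ ((hf' _ _ _).2 h0.symm)).mono (by simp +contextual), by simp⟩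

theorem definable_primrec {n : ℕ} {f : List.Vector ℕ n → ℕ} (hf : Nat.Primrec' f) :
    Definable (graph fun v => Part.some (f v)) := by
  induction hf with
  | zero => exact definable_zero
  | succ => exact definable_succ
  | get i => exact definable_get i
  | comp g _ _ ihf ihg =>
    have := definable_comp _ ihf ihg
    convert this using 3 with v
    rw [Vector.mOfFn_part_some, Part.bind_eq_bind, Part.bind_some]
  | prec _ _ ihf ihg => exact definable_prec ihf ihg

theorem definable_partrec {n : ℕ} {f : List.Vector ℕ n →. ℕ} (hf : Nat.Partrec' f) :
    Definable (graph f) := by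
  induction hf with
  | prim hf => exact definable_primrec hf
  | comp g _ _ ihf ihg => exact definable_comp g ihf ihg
  | rfind _ ihf => exact definable_rfind ihf

/-! ### Numerical symbols, range restriction and undecidability -/

/-- Relabelling of symbols by positive numbers; the symbol `0` is reserved for a predicate true of
every number. -/
def relabelAtom (lab : α → ℕ) (a : Atom α) : Atom ℕ := (lab a.1 + 1, a.2)

/-- Relabelling of a clause, with a premise for each variable of the head. -/
def relabelClause (lab : α → ℕ) (c : Clause α) : Clause ℕ :=
  ((Atom.vars c.2).map (fun i => (0, [Term.var i])) ++ c.1.map (relabelAtom lab),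
    relabelAtom lab c.2)

def relabel (lab : α → ℕ) (C : List (Clause α)) : List (Clause ℕ) :=
  ([], (0, [Term.zero])) :: ([(0, [Term.var 0])], (0, [Term.succ (Term.var 0)])) ::
    C.map (relabelClause lab)

/-- Every variable of the head of a clause occurs in a premise. -/
def RangeRestricted (C : List (Clause α)) : Prop :=
  ∀ c ∈ C, ∀ i ∈ Atom.vars c.2, ∃ a ∈ c.1, i ∈ Atom.vars a

theorem rangeRestricted_relabel (lab : α → ℕ) (C : List (Clause α)) :
    RangeRestricted (relabel lab C) := by
  intro c hc i hi
  simp only [relabel, List.mem_cons, List.mem_map] at hc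
  rcases hc with rfl | rfl | ⟨c, -, rfl⟩
  · simp [Atom.vars, Term.vars] at hi
  · simpa [Atom.vars, Term.vars] using hi
  · refine ⟨(0, [Term.var i]), ?_, by simp [Atom.vars, Term.vars]⟩
    exact List.mem_append_left _ (List.mem_map.2 ⟨i, hi, rfl⟩)

theorem derives_relabel_nat (lab : α → ℕ) (C : List (Clause α)) (n : ℕ) :
    Derives (relabel lab C) (0, [n]) := by
  induction n with
  | zero => exact .of_clause List.mem_cons_self (fun _ => 0) rfl (by simp)
  | succ n ih =>
    refine .of_clause (List.mem_cons_of_mem _ List.mem_cons_self) (fun _ => n) rfl ?_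
    simp only [List.forall_mem_singleton]
    exact ih

theorem Derives.relabel {C : List (Clause α)} {f : Fact α} (h : Derives C f) (lab : α → ℕ) :
    Derives (relabel lab C) (lab f.1 + 1, f.2) := by
  induction h with
  | step c hc ν _ ih =>
    refine .of_clause (p := (relabelClause lab c).1) (a := relabelAtom lab c.2)
      (List.mem_cons_of_mem _ (List.mem_cons_of_mem _ (List.mem_map.2 ⟨c, hc, rfl⟩))) ν rfl ?_
    intro b hb
    rcases List.mem_append.1 hb with hb | hb
    · obtain ⟨i, -, rfl⟩ := List.mem_map.1 hb
      exact derives_relabel_nat lab C _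
    · obtain ⟨a, ha, rfl⟩ := List.mem_map.1 hb
      exact ih a ha

theorem Definable.exists_relabel {P : Pred} (h : Definable P) :
    ∃ (C : List (Clause ℕ)) (p : ℕ), RangeRestricted C ∧ ∀ l, Derives C (p, l) ↔ P l := by
  obtain ⟨C, hC, hD⟩ := h
  set T : List Pred := P :: C.flatMap fun c => c.2.1 :: c.1.map Prod.fst with hT
  obtain ⟨lab, hlab⟩ := Set.countable_iff_exists_injOn.1 (List.finite_toSet T).countable
  refine ⟨relabel lab C, lab P + 1, rangeRestricted_relabel lab C, fun l =>
    ⟨fun h => ?_, fun h => (hD l h).relabel lab⟩⟩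
  -- `lab` is injective only on the finitely many symbols in use, so only these are interpreted;
  -- facts with symbol 0 hold vacuously.
  have hI : Holds (fun f : Fact ℕ => ∀ Q ∈ T, lab Q + 1 = f.1 → Q f.2) (relabel lab C) := by
    refine .cons (fun ν _ Q _ h => absurd h (by simp [Atom.inst]))
      (.cons (fun ν _ Q _ h => absurd h (by simp [Atom.inst])) ?_)
    intro c' hc'
    obtain ⟨c, hc, rfl⟩ := List.mem_map.1 hc'
    intro ν hp Q hQ hQc
    have hcT : ∀ R ∈ c.2.1 :: c.1.map Prod.fst, R ∈ T := fun R hR =>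
      List.mem_cons_of_mem _ (List.mem_flatMap.2 ⟨c, hc, hR⟩)
    obtain rfl : Q = c.2.1 := hlab hQ (hcT _ List.mem_cons_self) (Nat.succ_injective hQc)
    refine hC c hc ν fun a ha => ?_
    exact hp (relabelAtom lab a) (List.mem_append_right _ (List.mem_map_of_mem ha)) a.1
      (hcT _ (List.mem_cons_of_mem _ (List.mem_map_of_mem ha))) rfl
  exact h.sound hI P List.mem_cons_self rfl

/-- A list of Horn clauses with an undecidable derivability problem. -/
theorem exists_undecidable :
    ∃ (C : List (Clause ℕ)) (p : ℕ), RangeRestricted C ∧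
      ¬ ComputablePred fun n : ℕ => Derives C (p, [n]) := by
  let f : ℕ →. ℕ := fun n => (Nat.Partrec.Code.ofNatCode n).eval 0
  have hf : Partrec f := by
    have h : Partrec fun n : ℕ => (Denumerable.ofNat Nat.Partrec.Code n).eval 0 :=
      Nat.Partrec.Code.eval_part.comp (Computable.ofNat _) (Computable.const 0)
    exact h
  have hdef := definable_partrec (Nat.Partrec'.part_iff₁.2 hf)
  obtain ⟨D, hD, hDf⟩ := hdef
  set P := graph fun v : List.Vector ℕ 1 => f v.head with hP
  have hPmem (y n : ℕ) : P [y, n] ↔ y ∈ f n := graph_cons _ (n ::ᵥ List.Vector.nil) y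
  set H : Pred := fun l => ∃ n, l = [n] ∧ (f n).Dom
  have hH : Definable H := by
    refine ⟨([(P, [Term.var 0, Term.var 1])], (H, [Term.var 1])) :: D, .cons ?_ hD, ?_⟩
    · intro ν h
      have h : P [ν 0, ν 1] := by simpa [Atom.inst, selfTrue, Term.eval] using h
      exact ⟨ν 1, rfl, Part.dom_iff_mem.2 ⟨_, (hPmem _ _).1 h⟩⟩
    · rintro _ ⟨n, rfl, hn⟩
      obtain ⟨y, hy⟩ := Part.dom_iff_mem.1 hn
      refine .of_clause List.mem_cons_self (assign y n []) rfl ?_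
      simp only [List.forall_mem_singleton]
      exact (hDf _ ((hPmem y n).2 hy)).mono (by simp +contextual)
  obtain ⟨C, p, hC, hCp⟩ := hH.exists_relabel
  refine ⟨C, p, hC, fun h => ComputablePred.halting_problem 0 ?_⟩
  refine ComputablePred.computable_of_manyOneReducible ⟨Encodable.encode, Computable.encode, ?_⟩ h
  intro c
  rw [hCp]
  have : f (Encodable.encode c) = c.eval 0 := by
    change (Denumerable.ofNat Nat.Partrec.Code (Encodable.encode c)).eval 0 = _
    rw [Denumerable.ofNat_encode]
  simp [H, this]

end Horn

namespace HybridLogic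

open Horn

/-! ### The reduction formula and its behaviour under substitution -/

namespace Formula

def top : Formula := neg bot
def or (φ ψ : Formula) : Formula := neg (and (neg φ) (neg ψ))
def dia (φ : Formula) : Formula := neg (box (neg φ))
def diah (φ : Formula) : Formula := neg (boxh (neg φ))

def conj : List Formula → Formula
  | [] => top
  | φ :: l => and φ (conj l)

/-- The points in `φ` with no successor in `φ`. -/
def hat (φ : Formula) : Formula := and φ (box (neg φ))

/-- A term as a formula; it denotes the first number at which the formula is true. -/
def ofTerm : Term → Formula
  | .zero => top
  | .var i => var i
  | .succ t => dia (hat (ofTerm t))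

/-- The `i`-th argument is `t`. -/
def argIs (i : ℕ) (t : Term) : Formula :=
  dia (and (dia (nom i)) (and (dia (hat (ofTerm t))) (neg (dia (hat (ofTerm (.succ t)))))))

/-- The arguments from the `i`-th on are those of the list. -/
def argsAre : ℕ → List Term → Formula
  | i, [] => neg (dia (nom i))
  | i, t :: l => and (argIs i t) (argsAre (i + 1) l)

/-- The tuple of terms that represents an atom; it begins with the numeral of the symbol. -/
def tuple (a : Atom ℕ) : List Term := Term.ofNat a.1 :: a.2

def ofAtom (a : Atom ℕ) : Formula := diah (argsAre 0 (tuple a))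

def ofFact (f : Fact ℕ) : Formula := ofAtom (f.1, f.2.map Term.ofNat)

/-- The premises of a clause are true and its head is false. -/
def clauseFails (c : Clause ℕ) : Formula :=
  and (conj (c.1.map ofAtom)) (neg (ofAtom c.2))

/-- `φ` is true at all points reachable in at most `n` steps. -/
def boxLe : ℕ → Formula → Formula
  | 0, φ => φ
  | n + 1, φ => and φ (box (boxLe n φ))

/-- The box depth. -/
def depth : Formula → ℕ
  | bot => 0
  | var _ => 0
  | nom _ => 0
  | neg φ => depth φ
  | box φ => depth φ + 1
  | boxh φ => depth φ
  | and φ ψ => max (depth φ) (depth ψ)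

def clausesDepth (C : List (Clause ℕ)) : ℕ :=
  (C.flatMap fun c => (c.2 :: c.1).map fun a => depth (argsAre 0 (tuple a))).sum

/-- The points `□ₕ`-accessible from here, and the points near them, have the point named by the
nominal `0` as an `S`-successor. -/
def linked (n : ℕ) : Formula := boxh (boxLe n (diah (nom 0)))

def hypothesis (C : List (Clause ℕ)) : Formula :=
  and (nom 0) (and (linked (clausesDepth C)) (conj (C.map fun c => neg (clauseFails c))))

/-- If the clauses of `C` hold, then so does the fact `f`. -/
def reduction (C : List (Clause ℕ)) (f : Fact ℕ) : Formula :=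
  neg (and (hypothesis C) (neg (ofFact f)))

end Formula

open Formula

section Truth

variable {F : Frame.{u}} (V : Valuation F) (x : F.W)

theorem truth_nom (i : ℕ) : Truth F V x (.nom i) ↔ x = V.nom i := Iff.rfl

theorem truth_neg (φ : Formula) : Truth F V x (.neg φ) ↔ ¬ Truth F V x φ := Iff.rfl

theorem truth_box (φ : Formula) : Truth F V x (.box φ) ↔ ∀ y, F.R x y → Truth F V y φ := Iff.rfl

theorem truth_boxh (φ : Formula) : Truth F V x (.boxh φ) ↔ ∀ y, F.S x y → Truth F V y φ := Iff.rfl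

theorem truth_and (φ ψ : Formula) :
    Truth F V x (.and φ ψ) ↔ Truth F V x φ ∧ Truth F V x ψ := Iff.rfl

theorem truth_top : Truth F V x top := not_false

theorem truth_or (φ ψ : Formula) :
    Truth F V x (.or φ ψ) ↔ Truth F V x φ ∨ Truth F V x ψ := by
  simp only [Formula.or, truth_neg, truth_and]; tauto

theorem truth_dia (φ : Formula) :
    Truth F V x (dia φ) ↔ ∃ y, F.R x y ∧ Truth F V y φ := by
  simp [dia, truth_neg, truth_box]

theorem truth_diah (φ : Formula) :
    Truth F V x (diah φ) ↔ ∃ y, F.S x y ∧ Truth F V y φ := by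
  simp [diah, truth_neg, truth_boxh]

theorem truth_conj (l : List Formula) : Truth F V x (conj l) ↔ ∀ φ ∈ l, Truth F V x φ := by
  induction l with
  | nil => simp [conj, truth_top]
  | cons φ l ih => simp [conj, truth_and, ih]

theorem truth_subst (σ : ℕ → Formula) (φ : Formula) :
    Truth F V x (φ.subst σ) ↔ Truth F ⟨fun i => {y | Truth F V y (σ i)}, V.nom⟩ x φ := by
  induction φ generalizing x with
  | bot => exact Iff.rfl
  | var i => exact Iff.rfl
  | nom i => exact Iff.rfl
  | neg φ ih => exact not_congr (ih x)
  | box φ ih => exact forall₂_congr fun y _ => ih y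
  | boxh φ ih => exact forall₂_congr fun y _ => ih y
  | and φ ψ ih₁ ih₂ => exact and_congr (ih₁ x) (ih₂ x)

end Truth

section Subst

theorem subst_ofTerm (ν : ℕ → ℕ) (t : Term) :
    (ofTerm t).subst (fun i => ofTerm (Term.ofNat (ν i))) = ofTerm (Term.ofNat (t.eval ν)) := by
  induction t with
  | zero => rfl
  | var i => rfl
  | succ t ih => simp [ofTerm, dia, hat, Formula.subst, ih, Term.eval, Term.ofNat]

theorem subst_argsAre (ν : ℕ → ℕ) (i : ℕ) (l : List Term) :
    (argsAre i l).subst (fun i => ofTerm (Term.ofNat (ν i))) =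
      argsAre i (l.map fun t => Term.ofNat (t.eval ν)) := by
  induction l generalizing i with
  | nil => rfl
  | cons t l ih =>
    simp only [argsAre, List.map_cons, Formula.subst, ih, argIs, dia, hat, subst_ofTerm, ofTerm]

/-- An equality of formulas, not just an equivalence: `ofTerm` treats a successor as `Term.ofNat`
does, so substituting numerals computes the term. -/
theorem subst_ofAtom (ν : ℕ → ℕ) (a : Atom ℕ) :
    (ofAtom a).subst (fun i => ofTerm (Term.ofNat (ν i))) = ofFact (Atom.inst ν a) := by
  simp [ofAtom, ofFact, diah, Formula.subst, subst_argsAre, Atom.inst, tuple, Term.eval_ofNat,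
    Function.comp_def]

theorem subst_ofTerm_ofNat (σ : ℕ → Formula) (n : ℕ) :
    (ofTerm (Term.ofNat n)).subst σ = ofTerm (Term.ofNat n) := by
  induction n with
  | zero => rfl
  | succ n ih => simp [ofTerm, dia, hat, Formula.subst, ih, Term.ofNat]

theorem subst_argsAre_ofNat (σ : ℕ → Formula) (i : ℕ) (l : List ℕ) :
    (argsAre i (l.map Term.ofNat)).subst σ = argsAre i (l.map Term.ofNat) := by
  induction l generalizing i with
  | nil => rfl
  | cons n l ih =>
    have h := subst_ofTerm_ofNat σ (n + 1)
    simp only [Term.ofNat] at h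
    simp only [argsAre, List.map_cons, Formula.subst, ih, argIs, dia, hat, subst_ofTerm_ofNat, h]

theorem subst_ofFact (σ : ℕ → Formula) (f : Fact ℕ) : (ofFact f).subst σ = ofFact f := by
  have h := subst_argsAre_ofNat σ 0 (f.1 :: f.2)
  simpa [ofFact, ofAtom, tuple, diah, Formula.subst] using h

theorem subst_boxLe (σ : ℕ → Formula) (n : ℕ) (φ : Formula) :
    (boxLe n φ).subst σ = boxLe n (φ.subst σ) := by
  induction n with
  | zero => rfl
  | succ n ih => simp [boxLe, Formula.subst, ih]

theorem subst_linked (σ : ℕ → Formula) (n : ℕ) : (linked n).subst σ = linked n := by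
  simp [linked, Formula.subst, subst_boxLe, diah]

theorem subst_conj (σ : ℕ → Formula) (l : List Formula) :
    (conj l).subst σ = conj (l.map (Formula.subst σ)) := by
  induction l with
  | nil => rfl
  | cons φ l ih => simp [conj, Formula.subst, ih]

end Subst

/-! ### Derivable facts give unifiers -/

section Unifier

/-- Formulas without `□ₕ`. -/
def NoBoxh : Formula → Prop
  | .bot => True
  | .var _ => True
  | .nom _ => True
  | .neg φ => NoBoxh φ
  | .box φ => NoBoxh φ
  | .boxh _ => False
  | .and φ ψ => NoBoxh φ ∧ NoBoxh ψ

theorem noBoxh_ofTerm (t : Term) : NoBoxh (ofTerm t) := by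
  induction t with
  | zero => trivial
  | var i => trivial
  | succ t ih => simp [ofTerm, dia, hat, NoBoxh, ih]

theorem noBoxh_argsAre (i : ℕ) (l : List Term) : NoBoxh (argsAre i l) := by
  induction l generalizing i with
  | nil => simp [argsAre, dia, NoBoxh]
  | cons t l ih => simp [argsAre, argIs, dia, hat, NoBoxh, ih, noBoxh_ofTerm]

theorem depth_le_clausesDepth {C : List (Clause ℕ)} {c : Clause ℕ} (hc : c ∈ C) {a : Atom ℕ}
    (ha : a ∈ c.2 :: c.1) : depth (argsAre 0 (tuple a)) ≤ clausesDepth C := by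
  refine List.le_sum_of_mem (List.mem_flatMap.2 ⟨c, hc, List.mem_map.2 ⟨a, ha, rfl⟩⟩)

variable {F : Frame.{u}} (V : Valuation F)

/-- Substitutions that agree near a point agree on formulas of small depth. -/
theorem truth_subst_congr {σ τ : ℕ → Formula} {x : F.W} {χ φ : Formula} {n : ℕ}
    (h : ∀ y, Truth F V y χ → ∀ i, Truth F V y (σ i) ↔ Truth F V y (τ i))
    (hφ : NoBoxh φ) (hn : depth φ ≤ n) (hx : Truth F V x (boxLe n χ)) :
    Truth F V x (φ.subst σ) ↔ Truth F V x (φ.subst τ) := by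
  induction φ generalizing x n with
  | bot => exact Iff.rfl
  | var i =>
    refine h x ?_ i
    cases n with
    | zero => exact hx
    | succ n => exact hx.1
  | nom i => exact Iff.rfl
  | neg φ ih => exact not_congr (ih hφ hn hx)
  | box φ ih =>
    cases n with
    | zero => simp [depth] at hn
    | succ n => exact forall₂_congr fun y hy => ih hφ (Nat.le_of_succ_le_succ hn) (hx.2 y hy)
  | boxh φ => exact hφ.elim
  | and φ ψ ih₁ ih₂ =>
    exact and_congr (ih₁ hφ.1 (le_trans (le_max_left _ _) hn) hx)
      (ih₂ hφ.2 (le_trans (le_max_right _ _) hn) hx)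

/-- The clause instance fails at the point named by the nominal `0`. -/
def instanceFails (d : Clause ℕ × (ℕ → ℕ)) : Formula :=
  diah (and (nom 0) ((clauseFails d.1).subst fun i => ofTerm (Term.ofNat (d.2 i))))

/-- The value of a variable in the first failing clause instance. -/
def pickFirst : List (Clause ℕ × (ℕ → ℕ)) → ℕ → Formula
  | [], _ => bot
  | d :: D, i => Formula.or (and (instanceFails d) (ofTerm (Term.ofNat (d.2 i))))
      (and (neg (instanceFails d)) (pickFirst D i))

/-- The nominal makes `diah` look at a single point, so the answer is the same at all points that
see it. -/
theorem truth_instanceFails {x y : F.W} (hx : x = V.nom 0) (hy : Truth F V y (diah (nom 0)))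
    (d : Clause ℕ × (ℕ → ℕ)) : Truth F V y (instanceFails d) ↔
      Truth F V x ((clauseFails d.1).subst fun i => ofTerm (Term.ofNat (d.2 i))) := by
  rw [truth_diah] at hy
  obtain ⟨z, hz, rfl⟩ := hy
  subst hx
  simp only [instanceFails, truth_diah, truth_and, truth_nom]
  constructor
  · rintro ⟨z, -, rfl, h⟩
    exact h
  · exact fun h => ⟨_, hz, rfl, h⟩

theorem exists_pickFirst {x : F.W} (hx : x = V.nom 0) (D : List (Clause ℕ × (ℕ → ℕ)))
    (h : ∃ d ∈ D, Truth F V x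
      ((clauseFails d.1).subst fun i => ofTerm (Term.ofNat (d.2 i)))) :
    ∃ d ∈ D, Truth F V x ((clauseFails d.1).subst fun i => ofTerm (Term.ofNat (d.2 i))) ∧
      ∀ y, Truth F V y (diah (nom 0)) → ∀ i,
        Truth F V y (pickFirst D i) ↔ Truth F V y (ofTerm (Term.ofNat (d.2 i))) := by
  induction D with
  | nil => simp at h
  | cons d D ih =>
    by_cases hd : Truth F V x ((clauseFails d.1).subst fun i => ofTerm (Term.ofNat (d.2 i)))
    · refine ⟨d, List.mem_cons_self, hd, fun y hy i => ?_⟩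
      simp [pickFirst, truth_or, truth_and, truth_neg, truth_instanceFails V hx hy, hd]
    · obtain ⟨e, he, hex, hey⟩ := ih (by simpa [hd] using h)
      refine ⟨e, List.mem_cons_of_mem _ he, hex, fun y hy i => ?_⟩
      simp [pickFirst, truth_or, truth_and, truth_neg, truth_instanceFails V hx hy, hd,
        hey y hy i]

theorem truth_subst_ofAtom_congr {σ τ : ℕ → Formula} {x : F.W} {n : ℕ} {a : Atom ℕ}
    (h : ∀ y, Truth F V y (diah (nom 0)) → ∀ i, Truth F V y (σ i) ↔ Truth F V y (τ i))
    (hn : depth (argsAre 0 (tuple a)) ≤ n) (hx : Truth F V x (linked n)) :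
    Truth F V x ((ofAtom a).subst σ) ↔ Truth F V x ((ofAtom a).subst τ) := by
  have hd (ρ : ℕ → Formula) :
      (ofAtom a).subst ρ = diah ((argsAre 0 (tuple a)).subst ρ) := rfl
  rw [hd, hd, truth_diah, truth_diah]
  exact exists_congr fun y => and_congr_right fun hy =>
    truth_subst_congr V h (noBoxh_argsAre _ _) hn (hx y hy)

theorem truth_subst_clauseFails {σ : ℕ → Formula} {x : F.W} {c : Clause ℕ} :
    Truth F V x ((clauseFails c).subst σ) ↔
      (∀ a ∈ c.1, Truth F V x ((ofAtom a).subst σ)) ∧ ¬ Truth F V x ((ofAtom c.2).subst σ) := by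
  simp only [clauseFails, Formula.subst, truth_and, truth_neg, subst_conj, truth_conj,
    List.map_map, List.forall_mem_map, Function.comp_apply]

/-- The substitution agrees with the numerals of one failing instance at every point that matters,
so it makes the uninstantiated clause fail too. -/
theorem exists_valid_subst {C : List (Clause ℕ)} {f : Fact ℕ} (h : Derives C f) :
    ∃ σ, (reduction C f).subst σ ∈ KH2.{u} := by
  obtain ⟨D, hDC, hD⟩ := h.exists_instances
  refine ⟨pickFirst D, fun F V x => ?_⟩
  simp only [reduction, hypothesis, Formula.subst, truth_neg, truth_and, truth_nom, subst_linked,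
    subst_conj, subst_ofFact, truth_conj, List.map_map]
  rintro ⟨⟨hx, hlink, hC⟩, hf⟩
  have hex : ∃ d ∈ D, Truth F V x
      ((clauseFails d.1).subst fun i => ofTerm (Term.ofNat (d.2 i))) := by
    -- If no instance failed, truth at `x` would be closed under the instances in `D`, and `f` would
    -- be true.
    by_contra! hno
    refine hf (hD (fun g => Truth F V x (ofFact g)) fun d hd hp => ?_)
    have := hno d hd
    rw [truth_subst_clauseFails] at this
    simp only [subst_ofAtom] at this
    by_contra hc
    exact this ⟨hp, hc⟩
  obtain ⟨d, hd, hdx, hpick⟩ := exists_pickFirst V hx D hex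
  refine hC _ (List.mem_map.2 ⟨d.1, hDC d hd, rfl⟩) ?_
  rw [truth_subst_clauseFails] at hdx
  refine (truth_subst_clauseFails V).2 ⟨fun a ha => ?_, fun hc => hdx.2 ?_⟩
  · exact (truth_subst_ofAtom_congr V hpick (depth_le_clausesDepth (hDC d hd)
      (List.mem_cons_of_mem _ ha)) hlink).2 (hdx.1 a ha)
  · exact (truth_subst_ofAtom_congr V hpick (depth_le_clausesDepth (hDC d hd)
      List.mem_cons_self) hlink).1 hc

end Unifier

/-! ### The standard frame -/

/-- The points of the standard frame of a set of tuples of numbers: labels, numbers, arguments (a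
number together with a position), and the tuples themselves. -/
inductive Point (I : List ℕ → Prop) : Type u
  | lbl : ℕ → Point I
  | num : ℕ → Point I
  | arg : ℕ → ℕ → Point I
  | tup : (l : List ℕ) → I l → Point I

/-- Labels are reflexive, so `hat` is false there; numbers see the smaller ones, so `hat` picks a
least element. Tuples see numbers for the sake of transitivity, and labels also to reveal their
length. -/
def Point.rel {I : List ℕ → Prop} : Point.{u} I → Point.{u} I → Prop
  | lbl i, lbl j => i = j
  | num k, num m => m < k
  | arg i _, lbl j => i = j
  | arg _ k, num m => m ≤ k
  | tup l _, lbl j => j < l.length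
  | tup l _, num m => ∃ k ∈ l, m ≤ k
  | tup l _, arg i k => l[i]? = some k
  | _, _ => False

theorem Point.rel_trans {I : List ℕ → Prop} (x y z : Point.{u} I) (hxy : x.rel y)
    (hyz : y.rel z) : x.rel z := by
  cases x <;> cases y <;> simp only [rel] at hxy <;> cases z <;> simp only [rel] at hyz ⊢
  · omega
  · omega
  · omega
  · omega
  · omega
  · obtain ⟨k, hk, h⟩ := hxy
    exact ⟨k, hk, by omega⟩
  · subst hyz
    exact (List.getElem?_eq_some_iff.1 hxy).1
  · exact ⟨_, List.mem_of_getElem? hxy, hyz⟩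

/-- The standard frame. -/
abbrev stdFrame (I : List ℕ → Prop) : Frame.{u} where
  W := Point.{u} I
  R := Point.rel
  S _ _ := True

section Standard

variable {I : List ℕ → Prop} (v : ℕ → Set (Point.{u} I))

/-- The nominals denote the labels. -/
def stdVal : Valuation (stdFrame.{u} I) := ⟨v, Point.lbl⟩

/-- The term denotes the number. -/
def Denotes (k : ℕ) (t : Term) : Prop :=
  Truth (stdFrame I) (stdVal v) (Point.num k) (hat (ofTerm t))

theorem rel_num {k : ℕ} {y : Point.{u} I} :
    (Point.num k).rel y ↔ ∃ m < k, y = Point.num m := by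
  cases y <;> simp [Point.rel]

theorem rel_arg {i k : ℕ} {y : Point.{u} I} :
    (Point.arg i k).rel y ↔ y = Point.lbl i ∨ ∃ m ≤ k, y = Point.num m := by
  cases y <;> simp [Point.rel, eq_comm]

theorem rel_lbl_right {i : ℕ} {x : Point.{u} I} (h : x.rel (Point.lbl i)) :
    x = Point.lbl i ∨ (∃ k, x = Point.arg i k) ∨ ∃ l h, x = Point.tup l h := by
  cases x <;> simp_all [Point.rel]

theorem rel_arg_right {i k : ℕ} {x : Point.{u} I} (h : x.rel (Point.arg i k)) :
    ∃ l h, x = Point.tup l h ∧ l[i]? = some k := by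
  cases x <;> simp_all [Point.rel]

theorem not_truth_hat_lbl (i : ℕ) (φ : Formula) :
    ¬ Truth (stdFrame I) (stdVal v) (Point.lbl i) (hat φ) := fun h => h.2 (Point.lbl i) rfl h.1

theorem denotes_iff {k : ℕ} {t : Term} : Denotes v k t ↔
    Truth (stdFrame I) (stdVal v) (Point.num k) (ofTerm t) ∧
      ∀ m < k, ¬ Truth (stdFrame I) (stdVal v) (Point.num m) (ofTerm t) := by
  refine and_congr_right fun _ => ⟨fun h m hm => h (Point.num m) hm, fun h y hy => ?_⟩
  obtain ⟨m, hm, rfl⟩ := rel_num.1 hy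
  exact h m hm

variable {v} in
theorem Denotes.unique {k m : ℕ} {t : Term} (hk : Denotes v k t) (hm : Denotes v m t) : k = m := by
  rw [denotes_iff] at hk hm
  rcases lt_trichotomy k m with h | h | h
  · exact absurd hk.1 (hm.2 k h)
  · exact h
  · exact absurd hm.1 (hk.2 m h)

theorem denotes_zero {k : ℕ} : Denotes v k .zero ↔ k = 0 := by
  rw [denotes_iff]
  constructor
  · rintro ⟨-, h⟩
    by_contra hk
    exact h 0 (by omega) (truth_top _ _)
  · rintro rfl
    exact ⟨truth_top _ _, by simp⟩

theorem truth_num_succ {k : ℕ} {t : Term} :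
    Truth (stdFrame I) (stdVal v) (Point.num k) (ofTerm (.succ t)) ↔ ∃ m < k, Denotes v m t := by
  rw [ofTerm, truth_dia]
  constructor
  · rintro ⟨y, hy, h⟩
    obtain ⟨m, hm, rfl⟩ := rel_num.1 hy
    exact ⟨m, hm, h⟩
  · rintro ⟨m, hm, h⟩
    exact ⟨_, rel_num.2 ⟨m, hm, rfl⟩, h⟩

/-- If `t` denotes `m`, its successor formula is true at exactly the numbers above `m`, the least
being `m + 1`. -/
theorem denotes_succ {k : ℕ} {t : Term} :
    Denotes v k (.succ t) ↔ ∃ m, Denotes v m t ∧ k = m + 1 := by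
  rw [denotes_iff]
  simp only [truth_num_succ]
  constructor
  · rintro ⟨⟨m, hm, h⟩, hlt⟩
    refine ⟨m, h, ?_⟩
    by_contra hne
    exact hlt (m + 1) (by omega) ⟨m, by omega, h⟩
  · rintro ⟨m, h, rfl⟩
    refine ⟨⟨m, by omega, h⟩, ?_⟩
    rintro j hj ⟨i, hi, h'⟩
    have := h.unique h'
    omega

theorem truth_dia_hat_arg {i k : ℕ} {t : Term} :
    Truth (stdFrame I) (stdVal v) (Point.arg i k) (dia (hat (ofTerm t))) ↔
      ∃ m ≤ k, Denotes v m t := by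
  rw [truth_dia]
  constructor
  · rintro ⟨y, hy, h⟩
    rcases rel_arg.1 hy with rfl | ⟨m, hm, rfl⟩
    · exact absurd h (not_truth_hat_lbl v _ _)
    · exact ⟨m, hm, h⟩
  · rintro ⟨m, hm, h⟩
    exact ⟨_, rel_arg.2 (.inr ⟨m, hm, rfl⟩), h⟩

/-- An argument point sees the numbers up to its value `k`; seeing the denotation of `t` but not the
next number pins it to `k`. -/
theorem truth_argIs {x : Point.{u} I} {i : ℕ} {t : Term} :
    Truth (stdFrame I) (stdVal v) x (argIs i t) ↔
      ∃ l h k, x = Point.tup l h ∧ l[i]? = some k ∧ Denotes v k t := by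
  rw [argIs, truth_dia]
  simp only [truth_and, truth_neg]
  constructor
  · rintro ⟨y, hxy, hy, ht, hs⟩
    obtain ⟨z, hyz, rfl⟩ := (truth_dia _ _ _).1 hy
    -- Labels see only themselves, where `hat` is false, and nothing sees a tuple; only arguments
    -- remain.
    rcases rel_lbl_right hyz with rfl | ⟨k, rfl⟩ | ⟨l, hl, rfl⟩
    · obtain ⟨z, hz, h⟩ := (truth_dia _ _ _).1 ht
      cases z <;> first | exact hz.elim | exact absurd h (not_truth_hat_lbl v _ _)
    · rw [truth_dia_hat_arg] at ht hs
      obtain ⟨l, hl, rfl, hlk⟩ := rel_arg_right hxy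
      obtain ⟨m, hm, h⟩ := ht
      refine ⟨l, hl, k, rfl, hlk, ?_⟩
      obtain rfl : m = k := by
        by_contra hne
        exact hs ⟨m + 1, by omega, (denotes_succ v).2 ⟨m, h, rfl⟩⟩
      exact h
    · cases x <;> exact hxy.elim
  · rintro ⟨l, hl, k, rfl, hlk, h⟩
    refine ⟨Point.arg i k, hlk, (truth_dia _ _ _).2 ⟨Point.lbl i, rfl, rfl⟩,
      (truth_dia_hat_arg v).2 ⟨k, le_rfl, h⟩, ?_⟩
    rw [truth_dia_hat_arg]
    rintro ⟨m, hm, hm'⟩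
    obtain ⟨j, hj, rfl⟩ := (denotes_succ v).1 hm'
    have := h.unique hj
    omega

theorem truth_argsAre {l : List ℕ} (hl : I l) (i : ℕ) (ts : List Term) :
    Truth (stdFrame I) (stdVal v) (Point.tup l hl) (argsAre i ts) ↔
      List.Forall₂ (Denotes v) (l.drop i) ts := by
  induction ts generalizing i with
  | nil =>
    rw [argsAre, truth_neg, truth_dia, List.forall₂_nil_right_iff, List.drop_eq_nil_iff]
    constructor
    · intro h
      by_contra hlt
      exact h ⟨Point.lbl i, not_le.1 hlt, rfl⟩
    · rintro h ⟨y, hy, rfl⟩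
      exact absurd hy (not_lt.2 h)
  | cons t ts ih =>
    rw [argsAre, truth_and, truth_argIs, ih]
    constructor
    · rintro ⟨⟨l, hl, k, heq, hk, h⟩, hts⟩
      cases heq
      obtain ⟨hi, rfl⟩ := List.getElem?_eq_some_iff.1 hk
      rw [List.drop_eq_getElem_cons hi]
      exact .cons h hts
    · intro h
      by_cases hi : i < l.length
      · rw [List.drop_eq_getElem_cons hi, List.forall₂_cons] at h
        exact ⟨⟨l, hl, _, rfl, List.getElem?_eq_getElem hi, h.1⟩, h.2⟩
      · rw [List.drop_eq_nil_of_le (not_lt.1 hi)] at h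
        cases h

theorem truth_ofAtom {x : Point.{u} I} {a : Atom ℕ} :
    Truth (stdFrame I) (stdVal v) x (ofAtom a) ↔
      ∃ l, I l ∧ List.Forall₂ (Denotes v) l (tuple a) := by
  rw [ofAtom, truth_diah]
  constructor
  · rintro ⟨y, -, hy⟩
    -- `tuple a` is nonempty, as it starts with the symbol, so its first `argIs` forces the point to
    -- be a tuple.
    obtain ⟨l, hl, k, rfl, -, -⟩ := (truth_argIs v).1 ((truth_and _ _ _ _).1 hy).1
    exact ⟨l, hl, by simpa using (truth_argsAre v hl 0 (tuple a)).1 hy⟩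
  · rintro ⟨l, hl, h⟩
    exact ⟨Point.tup l hl, trivial, (truth_argsAre v hl 0 (tuple a)).2 (by simpa using h)⟩

open Classical in
/-- The numbers denoted by the variables. -/
noncomputable def denotation (i : ℕ) : ℕ :=
  if h : ∃ k, Denotes v k (.var i) then h.choose else 0

variable {v}

theorem Denotes.eq_denotation {k i : ℕ} (h : Denotes v k (.var i)) : k = denotation v i := by
  have hex : ∃ k, Denotes v k (.var i) := ⟨k, h⟩
  rw [denotation, dif_pos hex]
  exact h.unique hex.choose_spec

theorem Denotes.eval {k : ℕ} {t : Term} (h : Denotes v k t) :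
    k = t.eval (denotation v) ∧ ∀ i ∈ t.vars, Denotes v (denotation v i) (.var i) := by
  induction t generalizing k with
  | zero => exact ⟨(denotes_zero v).1 h, by simp [Term.vars]⟩
  | var i =>
    refine ⟨h.eq_denotation, ?_⟩
    simp only [Term.vars, List.mem_singleton, forall_eq]
    rwa [← h.eq_denotation]
  | succ t ih =>
    obtain ⟨m, hm, rfl⟩ := (denotes_succ v).1 h
    exact ⟨congrArg (· + 1) (ih hm).1, (ih hm).2⟩

theorem denotes_eval {t : Term} (h : ∀ i ∈ t.vars, Denotes v (denotation v i) (.var i)) :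
    Denotes v (t.eval (denotation v)) t := by
  induction t with
  | zero => exact (denotes_zero v).2 rfl
  | var i => exact h i (by simp [Term.vars])
  | succ t ih => exact (denotes_succ v).2 ⟨_, ih h, rfl⟩

theorem forall₂_denotes_iff {l : List ℕ} {ts : List Term} :
    List.Forall₂ (Denotes v) l ts ↔ l = ts.map (Term.eval (denotation v)) ∧
      ∀ t ∈ ts, ∀ i ∈ t.vars, Denotes v (denotation v i) (.var i) := by
  induction ts generalizing l with
  | nil => simp
  | cons t ts ih =>
    constructor
    · intro h
      cases h with
      | cons h hs =>
        rw [ih] at hs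
        simp only [List.map_cons, List.forall_mem_cons, List.cons.injEq]
        exact ⟨⟨h.eval.1, hs.1⟩, h.eval.2, hs.2⟩
    · rintro ⟨rfl, h⟩
      rw [List.forall_mem_cons] at h
      exact .cons (denotes_eval h.1) (ih.2 ⟨rfl, h.2⟩)

end Standard

/-- The tuples of the derivable facts. -/
def derivableTuples (C : List (Clause ℕ)) (l : List ℕ) : Prop :=
  ∃ f : Fact ℕ, Derives C f ∧ l = f.1 :: f.2

/-- The second conjunct is needed because a variable true at no number denotes nothing; it makes the
default value of `denotation` harmless. -/
theorem truth_ofAtom_derivable {C : List (Clause ℕ)}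
    {v : ℕ → Set (Point.{u} (derivableTuples C))} {x : Point.{u} (derivableTuples C)}
    {a : Atom ℕ} : Truth (stdFrame (derivableTuples C)) (stdVal v) x (ofAtom a) ↔
      Derives C (Atom.inst (denotation v) a) ∧
        ∀ i ∈ Atom.vars a, Denotes v (denotation v i) (.var i) := by
  simp only [truth_ofAtom, forall₂_denotes_iff, tuple, List.map_cons, Term.eval_ofNat,
    derivableTuples, List.forall_mem_cons, Term.vars_ofNat]
  constructor
  · rintro ⟨_, ⟨f, hf, rfl⟩, heq, -, h⟩
    obtain ⟨h₁, h₂⟩ := List.cons.inj heq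
    obtain rfl : f = Atom.inst (denotation v) a := Prod.ext h₁ h₂
    refine ⟨hf, fun i hi => ?_⟩
    obtain ⟨t, ht, hi⟩ := List.mem_flatMap.1 hi
    exact h t ht i hi
  · rintro ⟨hf, h⟩
    refine ⟨_, ⟨_, hf, rfl⟩, rfl, by simp, fun t ht i hi => h i (List.mem_flatMap.2 ⟨t, ht, hi⟩)⟩

theorem truth_boxLe_diah {C : List (Clause ℕ)} {v : ℕ → Set (Point.{u} (derivableTuples C))}
    (n : ℕ) (x : Point.{u} (derivableTuples C)) :
    Truth (stdFrame (derivableTuples C)) (stdVal v) x (boxLe n (diah (nom 0))) := by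
  have h (x : Point.{u} (derivableTuples C)) :
      Truth (stdFrame (derivableTuples C)) (stdVal v) x (diah (nom 0)) :=
    (truth_diah _ _ _).2 ⟨Point.lbl 0, trivial, rfl⟩
  induction n generalizing x with
  | zero => exact h x
  | succ n ih => exact ⟨h x, fun y _ => ih y⟩

/-! ### Unifiers give derivations -/

theorem derives_of_valid_subst {C : List (Clause ℕ)} (hC : RangeRestricted C) {f : Fact ℕ}
    {σ : ℕ → Formula} (h : (reduction C f).subst σ ∈ KH2_45.{u}) : Derives C f := by
  have h := h (stdFrame (derivableTuples C)) Point.rel_trans (fun _ _ => trivial)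
    (stdVal fun _ => ∅) (Point.lbl 0)
  rw [truth_subst] at h
  -- Only the valuation induced by the unifier matters from here on.
  set v : ℕ → Set (Point.{u} (derivableTuples C)) := fun i =>
    {y | Truth (stdFrame (derivableTuples C)) (stdVal fun _ => ∅) y (σ i)}
  change Truth (stdFrame (derivableTuples C)) (stdVal v) (Point.lbl 0) (reduction C f) at h
  rw [reduction, truth_neg, truth_and, truth_neg, not_and_not_right] at h
  have hf := h ⟨rfl, fun x _ => truth_boxLe_diah _ x, (truth_conj _ _ _).2 ?_⟩
  · rw [ofFact, truth_ofAtom_derivable] at hf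
    simpa [Atom.inst, Function.comp_def, Term.eval_ofNat] using hf.1
  · intro φ hφ
    obtain ⟨c, hc, rfl⟩ := List.mem_map.1 hφ
    rw [truth_neg, clauseFails, truth_and, truth_neg, truth_conj]
    simp only [List.forall_mem_map, truth_ofAtom_derivable]
    rintro ⟨hp, hn⟩
    refine hn ⟨.step c hc _ fun a ha => (hp a ha).1, fun i hi => ?_⟩
    -- Range restriction: a head variable occurs in a true premise, so it denotes.
    obtain ⟨a, ha, hia⟩ := hC c hc i hi
    exact (hp a ha).2 i hia

theorem unifiable_reduction_iff {L : Set Formula} (hL₁ : KH2.{u} ⊆ L) (hL₂ : L ⊆ KH2_45.{u})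
    {C : List (Clause ℕ)} (hC : RangeRestricted C) (f : Fact ℕ) :
    Unifiable L (reduction C f) ↔ Derives C f := by
  constructor
  · rintro ⟨σ, hσ⟩
    exact derives_of_valid_subst hC (hL₂ hσ)
  · intro h
    obtain ⟨σ, hσ⟩ := exists_valid_subst.{u} h
    exact ⟨σ, hL₁ hσ⟩

theorem bot_notMem {L : Set Formula} (hL₂ : L ⊆ KH2_45.{u}) : Formula.bot ∉ L := fun h =>
  hL₂ h (stdFrame fun _ => False) Point.rel_trans (fun _ _ => trivial) (stdVal fun _ => ∅)
    (Point.lbl 0)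

theorem admissible_bot_iff {L : Set Formula} (hL₂ : L ⊆ KH2_45.{u}) (φ : Formula) :
    Admissible L ([φ], .bot) ↔ ¬ Unifiable L φ := by
  simp [Admissible, Unifiable, Formula.subst, bot_notMem hL₂]

/-! ### Computability of the reduction -/

section Computability

variable {α : Type*} [Primcodable α]

theorem primrec_neg {f : α → Formula} (hf : Primrec f) : Primrec fun a => neg (f a) := by
  refine Primrec.encode_iff.1 ?_
  exact Primrec.nat_add.comp (Primrec.nat_mul.comp (Primrec.const 6) (Primrec.encode.comp hf))
    (Primrec.const 3)

theorem primrec_box {f : α → Formula} (hf : Primrec f) : Primrec fun a => box (f a) := by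
  refine Primrec.encode_iff.1 ?_
  exact Primrec.nat_add.comp (Primrec.nat_mul.comp (Primrec.const 6) (Primrec.encode.comp hf))
    (Primrec.const 4)

theorem primrec_boxh {f : α → Formula} (hf : Primrec f) : Primrec fun a => boxh (f a) := by
  refine Primrec.encode_iff.1 ?_
  exact Primrec.nat_add.comp (Primrec.nat_mul.comp (Primrec.const 6) (Primrec.encode.comp hf))
    (Primrec.const 5)

theorem primrec_and {f g : α → Formula} (hf : Primrec f) (hg : Primrec g) :
    Primrec fun a => and (f a) (g a) := by
  refine Primrec.encode_iff.1 ?_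
  exact Primrec.nat_add.comp (Primrec.nat_mul.comp (Primrec.const 6)
    (Primrec₂.natPair.comp (Primrec.encode.comp hf) (Primrec.encode.comp hg))) (Primrec.const 6)

theorem primrec_dia {f : α → Formula} (hf : Primrec f) : Primrec fun a => dia (f a) :=
  primrec_neg (primrec_box (primrec_neg hf))

theorem primrec_hat {f : α → Formula} (hf : Primrec f) : Primrec fun a => hat (f a) :=
  primrec_and hf (primrec_box (primrec_neg hf))

theorem primrec_ofNat : Primrec fun n : ℕ => ofTerm (Term.ofNat n) := by
  have h : Primrec (Nat.rec (motive := fun _ => Formula) top fun _ φ => dia (hat φ)) :=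
    Primrec.nat_rec₁ top (primrec_dia (primrec_hat Primrec.snd))
  refine h.of_eq fun n => ?_
  induction n with
  | zero => rfl
  | succ n ih => simp [Term.ofNat, ofTerm, ← ih]

theorem primrec_argIs (i : ℕ) {f : α → ℕ} (hf : Primrec f) :
    Primrec fun a => argIs i (Term.ofNat (f a)) := by
  have h := primrec_dia (primrec_hat (primrec_ofNat.comp hf))
  exact primrec_dia (primrec_and (Primrec.const _) (primrec_and h
    (primrec_neg (primrec_dia (primrec_hat h)))))

theorem computable_reduction (C : List (Clause ℕ)) (p : ℕ) :
    Computable fun n : ℕ => reduction C (p, [n]) := by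
  refine Primrec.to_comp (primrec_neg (primrec_and (Primrec.const _) (primrec_neg ?_)))
  -- Only the numeral of `n`, the argument at position 1, varies.
  exact primrec_neg (primrec_boxh (primrec_neg (primrec_and (Primrec.const (argIs 0 (Term.ofNat p)))
    (primrec_and (primrec_argIs 1 Primrec.id) (Primrec.const _)))))

end Computability

end HybridLogic

theorem theorem3 (L : Set HybridLogic.Formula)
    (hL₁ : HybridLogic.KH2.{u} ⊆ L) (hL₂ : L ⊆ HybridLogic.KH2_45.{u}) :
    ¬ ComputablePred (HybridLogic.Unifiable L) ∧
      ¬ ComputablePred (HybridLogic.Admissible L) := by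
  obtain ⟨C, p, hC, hund⟩ := Horn.exists_undecidable
  have hiff (n : ℕ) := HybridLogic.unifiable_reduction_iff hL₁ hL₂ hC (p, [n])
  have hred := HybridLogic.computable_reduction C p
  refine ⟨fun h => hund ?_, fun h => hund ?_⟩
  · exact ComputablePred.computable_of_manyOneReducible ⟨_, hred, fun n => (hiff n).symm⟩ h
  · refine ComputablePred.computable_of_manyOneReducible
      ⟨fun n => ([HybridLogic.Formula.reduction C (p, [n])], HybridLogic.Formula.bot), ?_,
        fun n => ?_⟩ h.not
    · exact Computable.pair (Computable.list_cons.comp hred (Computable.const []))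
        (Computable.const _)
    · rw [HybridLogic.admissible_bot_iff hL₂, not_not, hiff]
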